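/- There is a constant $C\in\mathbb N$ such that for every $k\in\mathbb N$ there is a single-commodity network consisting of a finite directed multigraph $(V,E)$ with $|V|\le C(k+1)$ and $|E|\le C(k+1)$, a source $s\in V$, a sink $t\in V$, a rational demand $d>0$, and affine edge cost functions $c_e^\lambda(y)=a_e y+b_e+g_e\lambda$ with rational constants $a_e>0$, $b_e\ge 0$, $g_e\ge 0$, for which the following holds. A feasible flow assigns a flow value $f_p\ge 0$ to each simple directed $s$-$t$-path $p$ such that $\sum_p f_p=d$; its edge loads are $x_e=\sum_{p\ni e}f_p$. It is a Wardrop equilibrium at price $\lambda$ if $f_p>0$ implies $\sum_{e\in p}c_e^\lambda(x_e)\le\sum_{e\in q}c_e^\lambda(x_e)$ for all simple $s$-$t$-paths $q$. For every $\lambda>0$ a Wardrop equilibrium exists and all Wardrop equilibria at price $\lambda$ have the same vector of edge loads $x(\lambda)\in\mathbb R^E$, and the map $\lambda\mapsto x(\lambda)$ on $(0,\infty)$ has at least $2^{k+1}$ breakpoints. Here a breakpoint is a $\lambda_0>0$ such that, for some $\varepsilon>0$, the map is affine on $[\lambda_0-\varepsilon,\lambda_0]$ and on $[\lambda_0,\lambda_0+\varepsilon]$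 with different slopes. -/

import Mathlib

/-- A single-commodity network: a finite directed multigraph with vertex type `V` and edge type `E`,
a source, a sink, a positive demand, and for every edge `e` the affine cost function
`y ↦ a e * y + b e + g e * price`, strictly increasing in the load `y`, with rational
coefficients `a e > 0`, `b e ≥ 0`, `g e ≥ 0`. -/
structure AffineNetwork (V E : Type) where
  /-- The tail of an edge. -/
  tail : E → V
  /-- The head of an edge. -/
  head : E → V
  /-- The source of the commodity. -/
  source : V
  /-- The sink of the commodity. -/
  sink : V
  /-- The demand of the commodity. -/
  demand : ℚ
  /-- The slope of the travel time of an edge. -/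
  a : E → ℚ
  /-- The offset of the travel time of an edge. -/
  b : E → ℚ
  /-- The externality factor of an edge. -/
  g : E → ℚ
  demand_pos : 0 < demand
  a_pos : ∀ e, 0 < a e
  b_nonneg : ∀ e, 0 ≤ b e
  g_nonneg : ∀ e, 0 ≤ g e

namespace AffineNetwork

/-- `N.IsWalk u p w`: the list of edges `p` is a directed walk from `u` to `w`. -/
def IsWalk {V E : Type} (N : AffineNetwork V E) : V → List E → V → Prop
  | u, [], w => u = w
  | u, e :: p, w => N.tail e = u ∧ N.IsWalk (N.head e) p w

/-- A simple path from source to sink: a directed walk that visits no vertex twice. -/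
def IsSimplePath {V E : Type} (N : AffineNetwork V E) (p : List E) : Prop :=
  N.IsWalk N.source p N.sink ∧ (N.source :: p.map N.head).Nodup

/-- The type of simple paths from source to sink. -/
def SimplePath {V E : Type} (N : AffineNetwork V E) : Type :=
  {p : List E // N.IsSimplePath p}

theorem finite_simplePath {V E : Type} [Fintype V] [Fintype E] (N : AffineNetwork V E) :
    Finite N.SimplePath := by
  refine Set.Finite.to_subtype ((List.finite_length_le E (Fintype.card V)).subset ?_)
  intro p hp
  have h := hp.2.length_le_card
  simp only [List.length_cons, List.length_map] at h
  exact (Nat.le_succ _).trans h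

noncomputable instance instFintypeSimplePath {V E : Type} [Fintype V] [Fintype E]
    (N : AffineNetwork V E) : Fintype N.SimplePath :=
  @Fintype.ofFinite _ N.finite_simplePath

/-- A feasible flow: nonnegative path flows that sum up to the demand. -/
def IsFeasible {V E : Type} [Fintype V] [Fintype E] (N : AffineNetwork V E)
    (f : N.SimplePath → ℝ) : Prop :=
  (∀ p, 0 ≤ f p) ∧ ∑ p, f p = (N.demand : ℝ)

open Classical in
/-- The load of an edge: the total flow on the paths that use it. -/
noncomputable def load {V E : Type} [Fintype V] [Fintype E] (N : AffineNetwork V E)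
    (f : N.SimplePath → ℝ) (e : E) : ℝ :=
  ∑ p : N.SimplePath, if e ∈ p.1 then f p else 0

/-- The cost of edge `e` at price `price` when its load is `y`. -/
noncomputable def edgeCost {V E : Type} (N : AffineNetwork V E) (price : ℝ) (e : E) (y : ℝ) : ℝ :=
  (N.a e : ℝ) * y + (N.b e : ℝ) + (N.g e : ℝ) * price

/-- The cost of a path under a flow: the sum of the costs of its edges at the current loads. -/
noncomputable def pathCost {V E : Type} [Fintype V] [Fintype E] (N : AffineNetwork V E)
    (price : ℝ) (f : N.SimplePath → ℝ) (p : N.SimplePath) : ℝ :=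
  (p.1.map fun e => N.edgeCost price e (N.load f e)).sum

/-- A Wardrop equilibrium at price `price`: a feasible flow that uses only cheapest paths. -/
def IsWardrop {V E : Type} [Fintype V] [Fintype E] (N : AffineNetwork V E)
    (price : ℝ) (f : N.SimplePath → ℝ) : Prop :=
  N.IsFeasible f ∧ ∀ p, 0 < f p → ∀ q, N.pathCost price f p ≤ N.pathCost price f q

/-- The Wardrop equilibria at price `price`, written as edge flows. -/
def IsWardropEdgeFlow {V E : Type} [Fintype V] [Fintype E] (N : AffineNetwork V E)
    (price : ℝ) (y : E → ℝ) : Prop :=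
  ∃ f : N.SimplePath → ℝ, N.IsWardrop price f ∧ N.load f = y

end AffineNetwork

/-- `t` is a breakpoint of `x`: `x` is affine on a small interval `[t - ε, t]` and on a small
interval `[t, t + ε]`, with different slopes. -/
def IsBreakpoint {E : Type} (x : ℝ → E → ℝ) (t : ℝ) : Prop :=
  ∃ ε : ℝ, 0 < ε ∧ ∃ m₁ m₂ : E → ℝ, m₁ ≠ m₂ ∧
    ∀ h : ℝ, 0 ≤ h → h ≤ ε → x (t - h) = x t - h • m₁ ∧ x (t + h) = x t + h • m₂

/-! The construction iterates Braess's paradox. Let `N` have demand `d`, and let its flow `u` and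
path cost `φ` grow from `(0, 0)` to `(d, 2d)`. Put `N` in place of the bridge of a Braess network of
demand `8d`. As the outer flow grows, everything first crosses the bridge, until `(u, φ) = (d, 2d)`.
From then on the bypasses are equally cheap, and balancing the costs forces the bridge flow back
down to 0. The outer network ends at `(8d, 16d)`, so the construction can be repeated. One upward
sweep outside is an upward and then a downward sweep inside; hence `n` nestings make the innermost
flow sweep `[0, 1]` exactly `2 ^ n` times.

A priced edge parallel to the nested network turns price into demand: raising the price pushes flow
off that edge. The sweeps are numbered by `i < 2 ^ n`. Binary digit `j` of `i` gives the direction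
of motion at depth `j`, and direction reverses between depths `j` and `j + 1` exactly when `Turns i
j`. Consecutive sweeps agree at their common end (`nestedState_succ_eq`), and prices increase along
each sweep because the outermost flow does (`nestedState_lt`). The innermost flow changes direction
between sweeps, so every interior knot is a breakpoint of the equilibrium, whose loads are unique by
strict monotonicity of the costs. -/

namespace AffineNetwork

/-! ### Uniqueness of equilibrium loads, and certificates by path decompositions and potentials. -/

section General

variable {V E : Type}

theorem SimplePath.nodup {N : AffineNetwork V E} (p : N.SimplePath) : p.1.Nodup :=
  (List.nodup_cons.1 p.2.2).2.of_map _

theorem IsWalk.append {N : AffineNetwork V E} {p q : List E} {u v w : V}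
    (hp : N.IsWalk u p v) (hq : N.IsWalk v q w) : N.IsWalk u (p ++ q) w := by
  induction p generalizing u with
  | nil => cases hp; exact hq
  | cons e p ih => exact ⟨hp.1, ih hp.2⟩

/-- The potential difference along a walk is a lower bound for its cost. -/
theorem IsWalk.potential_le {N : AffineNetwork V E} {c : E → ℝ} {π : V → ℝ}
    (hπ : ∀ e, π (N.head e) - π (N.tail e) ≤ c e) {p : List E} {u w : V}
    (hp : N.IsWalk u p w) : π w - π u ≤ (p.map c).sum := by
  induction p generalizing u with
  | nil => cases hp; simp
  | cons e p ih =>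
    have h1 := ih hp.2
    have h2 := hπ e
    rw [hp.1] at h2
    simp only [List.map_cons, List.sum_cons]
    linarith

/-- The cost of a walk consisting of tight edges is the potential difference. -/
theorem IsWalk.potential_eq {N : AffineNetwork V E} {c : E → ℝ} {π : V → ℝ}
    {p : List E} {u w : V} (hp : N.IsWalk u p w)
    (hπ : ∀ e ∈ p, π (N.head e) - π (N.tail e) = c e) : (p.map c).sum = π w - π u := by
  induction p generalizing u with
  | nil => cases hp; simp
  | cons e p ih =>
    have h1 := ih hp.2 fun e he => hπ e (List.mem_cons_of_mem _ he)
    have h2 := hπ e List.mem_cons_self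
    rw [hp.1] at h2
    simp only [List.map_cons, List.sum_cons]
    linarith

open Classical in
theorem SimplePath.sum_map [Fintype E] {N : AffineNetwork V E} (p : N.SimplePath) (c : E → ℝ) :
    (p.1.map c).sum = ∑ e, if e ∈ p.1 then c e else 0 := by
  rw [← List.sum_toFinset c p.nodup, ← Finset.sum_filter]
  congr 1
  ext e
  simp

theorem sum_mul_pathCost [Fintype V] [Fintype E] (N : AffineNetwork V E) (price : ℝ)
    (f f' : N.SimplePath → ℝ) :
    ∑ p, f' p * N.pathCost price f p =
      ∑ e, N.load f' e * N.edgeCost price e (N.load f e) := by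
  classical
  simp only [pathCost, SimplePath.sum_map, Finset.mul_sum]
  rw [Finset.sum_comm]
  refine Finset.sum_congr rfl fun e _ => ?_
  generalize N.edgeCost price e (N.load f e) = c
  rw [load, Finset.sum_mul]
  refine Finset.sum_congr rfl fun p _ => ?_
  split_ifs <;> simp

/-- No feasible flow is cheaper than a Wardrop equilibrium at the costs of the equilibrium. -/
theorem IsWardrop.sum_le [Fintype V] [Fintype E] {N : AffineNetwork V E} {price : ℝ}
    {f f' : N.SimplePath → ℝ} (hf : N.IsWardrop price f) (hf' : N.IsFeasible f') :
    ∑ p, f p * N.pathCost price f p ≤ ∑ p, f' p * N.pathCost price f p := by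
  have hd : (0 : ℝ) < N.demand := by exact_mod_cast N.demand_pos
  obtain ⟨p₀, -, hp₀⟩ : ∃ p ∈ Finset.univ, 0 < f p := by
    apply Finset.exists_lt_of_sum_lt
    rw [hf.1.2]
    simpa using hd
  have h1 : ∑ p, f p * N.pathCost price f p ≤ ∑ p, f p * N.pathCost price f p₀ := by
    refine Finset.sum_le_sum fun p _ => ?_
    rcases (hf.1.1 p).eq_or_lt with h | h
    · simp [← h]
    · exact mul_le_mul_of_nonneg_left (hf.2 p h p₀) h.le
  have h2 : ∑ p, f' p * N.pathCost price f p₀ ≤ ∑ p, f' p * N.pathCost price f p :=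
    Finset.sum_le_sum fun p _ => mul_le_mul_of_nonneg_left (hf.2 p₀ hp₀ p) (hf'.1 p)
  rw [← Finset.sum_mul, hf.1.2] at h1
  rw [← Finset.sum_mul, hf'.2] at h2
  exact h1.trans h2

/-- The edge loads of a Wardrop equilibrium are unique. -/
theorem IsWardropEdgeFlow.unique [Fintype V] [Fintype E] {N : AffineNetwork V E} {price : ℝ}
    {y y' : E → ℝ} (hy : N.IsWardropEdgeFlow price y) (hy' : N.IsWardropEdgeFlow price y') :
    y = y' := by
  obtain ⟨f, hf, rfl⟩ := hy
  obtain ⟨f', hf', rfl⟩ := hy'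
  have h1 := hf.sum_le hf'.1
  have h2 := hf'.sum_le hf.1
  simp only [sum_mul_pathCost] at h1 h2
  -- Adding the two variational inequalities cancels the offsets and prices and leaves this weighted
  -- square.
  have h3 : ∑ e, (N.a e : ℝ) * (N.load f e - N.load f' e) ^ 2 ≤ 0 := by
    have : ∑ e, (N.a e : ℝ) * (N.load f e - N.load f' e) ^ 2 =
        (∑ e, N.load f e * N.edgeCost price e (N.load f e) -
          ∑ e, N.load f' e * N.edgeCost price e (N.load f e)) +
        (∑ e, N.load f' e * N.edgeCost price e (N.load f' e) -
          ∑ e, N.load f e * N.edgeCost price e (N.load f' e)) := by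
      simp only [← Finset.sum_sub_distrib, ← Finset.sum_add_distrib]
      refine Finset.sum_congr rfl fun e _ => ?_
      simp only [edgeCost]
      ring
    linarith
  have ha : ∀ e, (0 : ℝ) < N.a e := fun e => by exact_mod_cast N.a_pos e
  have h4 := (Finset.sum_eq_zero_iff_of_nonneg fun e _ =>
    mul_nonneg (ha e).le (sq_nonneg _)).1 (h3.antisymm (Finset.sum_nonneg fun e _ =>
      mul_nonneg (ha e).le (sq_nonneg _)))
  funext e
  have h5 := h4 e (Finset.mem_univ e)
  rcases mul_eq_zero.1 h5 with h | h
  · exact absurd h (ha e).ne'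
  · exact sub_eq_zero.1 (pow_eq_zero_iff two_ne_zero |>.1 h)

open Classical in
/-- The edge flow `y` is a nonnegative combination of simple paths of total weight `u`. -/
def Decomposes (N : AffineNetwork V E) (u : ℝ) (y : E → ℝ) : Prop :=
  ∃ (ι : Type) (_ : Fintype ι) (P : ι → N.SimplePath) (w : ι → ℝ),
    (∀ i, 0 ≤ w i) ∧ ∑ i, w i = u ∧ ∀ e, y e = ∑ i, if e ∈ (P i).1 then w i else 0

/-- There are vertex potentials, equal to `-φ / 2` at the source and `φ / 2` at the sink, that
certify that `y` uses shortest paths only. -/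
def HasPotential (N : AffineNetwork V E) (price φ : ℝ) (y : E → ℝ) : Prop :=
  ∃ π : V → ℝ, π N.source = -φ / 2 ∧ π N.sink = φ / 2 ∧
    ∀ e, π (N.head e) - π (N.tail e) ≤ N.edgeCost price e (y e) ∧
      (0 < y e → π (N.head e) - π (N.tail e) = N.edgeCost price e (y e))

/-- Potential differences bound every path cost from below, with equality on paths whose edges all
carry load. This permits a check edge by edge, without enumerating the simple paths. -/
theorem Decomposes.isWardropEdgeFlow [Fintype V] [Fintype E] {N : AffineNetwork V E}
    {price φ : ℝ} {y : E → ℝ} (hy : N.Decomposes N.demand y) (hφ : N.HasPotential price φ y) :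
    N.IsWardropEdgeFlow price y := by
  classical
  obtain ⟨ι, _, P, w, hw, hsum, hload⟩ := hy
  obtain ⟨π, -, -, hπ⟩ := hφ
  -- The family `P` may repeat paths, so weights of equal paths are collected.
  let f : N.SimplePath → ℝ := fun p => ∑ i, if P i = p then w i else 0
  have hf0 : ∀ p, 0 ≤ f p := fun p => Finset.sum_nonneg fun i _ => by split_ifs <;> simp [hw]
  have hf : N.load f = y := by
    funext e
    rw [hload, load]
    have : ∀ p : N.SimplePath, (if e ∈ p.1 then f p else 0) =
        ∑ i, if P i = p then (if e ∈ p.1 then w i else 0) else 0 := by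
      intro p
      split_ifs with h <;> simp [f]
    simp only [this]
    rw [Finset.sum_comm]
    simp
  have hle : ∀ p : N.SimplePath, π N.sink - π N.source ≤ N.pathCost price f p := by
    intro p
    rw [pathCost, hf]
    exact p.2.1.potential_le fun e => (hπ e).1
  have heq : ∀ p : N.SimplePath, 0 < f p → N.pathCost price f p = π N.sink - π N.source := by
    intro p hp
    rw [pathCost, hf]
    refine p.2.1.potential_eq fun e he => (hπ e).2 ?_
    rw [← hf, load]
    refine Finset.sum_pos' (fun q _ => ?_) ⟨p, Finset.mem_univ _, ?_⟩
    · split_ifs <;> simp [hf0]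
    · simpa [he] using hp
  refine ⟨f, ⟨⟨hf0, ?_⟩, fun p hp q => (heq p hp).trans_le (hle q)⟩, hf⟩
  rw [← hsum]
  simp only [f]
  rw [Finset.sum_comm]
  simp

end General

/-! ### One Braess nesting step. -/

section Nest

variable {V E : Type}

/-- The Braess network whose bridge is the network `N`. The edges `(false, _)` enter and leave `N`,
the edges `(true, _)` bypass one half of the network. -/
def nest (N : AffineNetwork V E) : AffineNetwork (V ⊕ Bool) (E ⊕ Bool × Bool) where
  tail
    | .inl e => .inl (N.tail e)
    | .inr (false, false) => .inr false
    | .inr (false, true) => .inl N.sink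
    | .inr (true, false) => .inr false
    | .inr (true, true) => .inl N.source
  head
    | .inl e => .inl (N.head e)
    | .inr (false, false) => .inl N.source
    | .inr (false, true) => .inr true
    | .inr (true, false) => .inl N.sink
    | .inr (true, true) => .inr true
  source := .inr false
  sink := .inr true
  -- With `d` the inner demand, the offset `4 * d` makes the bypasses break even exactly at inner
  -- state `(d, 2 * d)`. With bypasses in use and inner state `(0, 0)`, the outer state is `(8 * d,
  -- 16 * d)`, which restores the ratio 2.
  demand := 8 * N.demand
  a := Sum.elim N.a fun i => if i.1 then 1 else 2
  b := Sum.elim N.b fun i => if i.1 then 4 * N.demand else 0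
  g := Sum.elim N.g fun _ => 0
  demand_pos := mul_pos (by norm_num) N.demand_pos
  a_pos := by
    rintro (e | ⟨_ | _, _⟩)
    · exact N.a_pos e
    all_goals simp
  b_nonneg := by
    have := N.demand_pos
    rintro (e | ⟨_ | _, _⟩)
    · exact N.b_nonneg e
    all_goals simp [this.le]
  g_nonneg := by
    rintro (e | _)
    · exact N.g_nonneg e
    · simp

/-- The edge flow on `N.nest` that sends `u'` units from source to sink and uses the edge flow `y`
of value `u` on the bridge. -/
noncomputable def nestFlow (u u' : ℝ) (y : E → ℝ) : E ⊕ Bool × Bool → ℝ :=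
  Sum.elim y fun i => if i.1 then (u' - u) / 2 else (u' + u) / 2

theorem IsWalk.map_inl {N : AffineNetwork V E} {p : List E} {u w : V} (hp : N.IsWalk u p w) :
    N.nest.IsWalk (.inl u) (p.map .inl) (.inl w) := by
  induction p generalizing u with
  | nil => cases hp; rfl
  | cons e p ih => exact ⟨congrArg Sum.inl hp.1, ih hp.2⟩

/-- The path in `N.nest` that traverses the bridge along a given path. -/
def SimplePath.nest {N : AffineNetwork V E} (p : N.SimplePath) : N.nest.SimplePath :=
  ⟨.inr (false, false) :: (p.1.map .inl ++ [.inr (false, true)]), by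
    refine ⟨⟨rfl, p.2.1.map_inl.append ⟨rfl, rfl⟩⟩, ?_⟩
    have h : ((N.source :: p.1.map N.head).map (Sum.inl : V → V ⊕ Bool)).Nodup :=
      p.2.2.map Sum.inl_injective
    simp only [List.map_cons, List.map_append, List.map_map, List.map_nil] at h ⊢
    rw [← List.cons_append, List.nodup_cons, List.nodup_append]
    refine ⟨?_, h, by simp, ?_⟩
    · simp [AffineNetwork.nest]
    · simp [AffineNetwork.nest]⟩

/-- The paths in `N.nest` that visit only the sink or only the source of the bridge. -/
def bypass (N : AffineNetwork V E) : Bool → N.nest.SimplePath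
  | false => ⟨[.inr (true, false), .inr (false, true)], by
      simp [IsSimplePath, IsWalk, nest]⟩
  | true => ⟨[.inr (false, false), .inr (true, true)], by
      simp [IsSimplePath, IsWalk, nest]⟩

theorem SimplePath.inl_mem_nest {N : AffineNetwork V E} (p : N.SimplePath) (e : E) :
    .inl e ∈ p.nest.1 ↔ e ∈ p.1 := by
  unfold SimplePath.nest
  simp

theorem SimplePath.inr_mem_nest {N : AffineNetwork V E} (p : N.SimplePath) (i : Bool × Bool) :
    .inr i ∈ p.nest.1 ↔ i.1 = false := by
  unfold SimplePath.nest
  rcases i with ⟨_ | _, _ | _⟩ <;> simp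

theorem mem_bypass (N : AffineNetwork V E) (e : E ⊕ Bool × Bool) (j : Bool) :
    e ∈ (N.bypass j).1 ↔ e = .inr (true, j) ∨ e = .inr (false, !j) := by
  cases j <;> simp [bypass, or_comm]

theorem Decomposes.nest {N : AffineNetwork V E} {u u' : ℝ} {y : E → ℝ} (hy : N.Decomposes u y)
    (hu : u ≤ u') : N.nest.Decomposes u' (nestFlow u u' y) := by
  classical
  obtain ⟨ι, _, P, w, hw, rfl, hload⟩ := hy
  refine ⟨ι ⊕ Bool, inferInstance, Sum.elim (fun i => (P i).nest) N.bypass,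
    Sum.elim w fun _ => (u' - ∑ i, w i) / 2, ?_, ?_, ?_⟩
  · rintro (i | _)
    · exact hw i
    · simp only [Sum.elim_inr]; linarith
  · simp only [Fintype.sum_sum_type, Sum.elim_inl, Sum.elim_inr, Fintype.sum_bool]
    ring
  · intro e
    rw [Fintype.sum_sum_type, Fintype.sum_bool]
    have h : nestFlow (∑ i, w i) u' y e = (∑ i, if e ∈ (P i).nest.1 then w i else 0) +
        ((if e ∈ (N.bypass true).1 then (u' - ∑ i, w i) / 2 else 0) +
          if e ∈ (N.bypass false).1 then (u' - ∑ i, w i) / 2 else 0) := by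
      obtain e | ⟨_ | _, _ | _⟩ := e
      · simp [SimplePath.inl_mem_nest, mem_bypass, nestFlow, hload]
      all_goals simp [SimplePath.inr_mem_nest, mem_bypass, nestFlow]
      all_goals ring
    convert h <;> rfl

/-- The inner potentials are kept. Thanks to the symmetric normalisation, the edges `(false, _)`, of
cost `u' + u`, are automatically tight, and both bypass edges yield the same condition. -/
theorem HasPotential.nest {N : AffineNetwork V E} {price φ u u' : ℝ} {y : E → ℝ}
    (hy : N.HasPotential price φ y) (hle : φ + u' + u ≤ (u' - u) / 2 + 4 * N.demand)
    (heq : u < u' → φ + u' + u = (u' - u) / 2 + 4 * N.demand) :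
    N.nest.HasPotential price (φ + 2 * (u' + u)) (nestFlow u u' y) := by
  obtain ⟨π, hs, ht, hπ⟩ := hy
  refine ⟨Sum.elim π fun i =>
    if i then (φ + 2 * (u' + u)) / 2 else -(φ + 2 * (u' + u)) / 2, rfl, rfl, ?_⟩
  rintro (e | ⟨_ | _, _ | _⟩)
  · exact hπ e
  all_goals
    simp only [AffineNetwork.nest, edgeCost, nestFlow, Sum.elim_inl, Sum.elim_inr, hs, ht,
      if_true, if_false, Bool.false_eq_true]
    refine ⟨by push_cast; linarith, fun h => ?_⟩
    first
      | (push_cast; linarith)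
      | (have := heq (by linarith); push_cast; linarith)

end Nest

/-! ### The priced parallel edge. -/

section Parallel

variable {V E : Type}

/-- The network `N` with an additional edge from the source to the sink that has a price. -/
def parallel (N : AffineNetwork V E) : AffineNetwork V (Option E) where
  tail e := e.elim N.source N.tail
  head e := e.elim N.sink N.head
  source := N.source
  sink := N.sink
  demand := N.demand
  -- This slope keeps the load-dependent cost of the priced edge at most 1 for loads up to the
  -- demand, which is used in `knotPrice_one_pos`.
  a e := e.elim (1 / N.demand) N.a
  b e := e.elim 0 N.b
  g e := e.elim 1 N.g
  demand_pos := N.demand_pos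
  a_pos := by
    rintro (_ | e)
    · exact one_div_pos.2 N.demand_pos
    · exact N.a_pos e
  b_nonneg := by
    rintro (_ | e)
    · exact le_rfl
    · exact N.b_nonneg e
  g_nonneg := by
    rintro (_ | e)
    · exact zero_le_one
    · exact N.g_nonneg e

/-- The edge flow on `N.parallel` with `r` units on the additional edge. -/
def parallelFlow (r : ℝ) (y : E → ℝ) : Option E → ℝ :=
  fun e => e.elim r y

theorem IsWalk.map_some {N : AffineNetwork V E} {p : List E} {u w : V} (hp : N.IsWalk u p w) :
    N.parallel.IsWalk u (p.map some) w := by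
  induction p generalizing u with
  | nil => exact hp
  | cons e p ih => exact ⟨hp.1, ih hp.2⟩

/-- A path of `N` as a path of `N.parallel`. -/
def SimplePath.parallel {N : AffineNetwork V E} (p : N.SimplePath) : N.parallel.SimplePath :=
  ⟨p.1.map some, p.2.1.map_some, by rw [List.map_map]; exact p.2.2⟩

theorem Decomposes.parallel {N : AffineNetwork V E} (hN : N.source ≠ N.sink) {u r : ℝ}
    {y : E → ℝ} (hy : N.Decomposes u y) (hr : 0 ≤ r) :
    N.parallel.Decomposes (u + r) (parallelFlow r y) := by
  classical
  obtain ⟨ι, _, P, w, hw, rfl, hload⟩ := hy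
  refine ⟨Option ι, inferInstance,
    fun i => i.elim ⟨[none], ⟨rfl, rfl⟩, by simpa [AffineNetwork.parallel] using hN⟩
      fun i => (P i).parallel, fun i => i.elim r w, ?_, ?_, ?_⟩
  · rintro (_ | i)
    · exact hr
    · exact hw i
  · simp [Fintype.sum_option, add_comm]
  · intro e
    rw [Fintype.sum_option]
    have h : parallelFlow r y e =
        (if e ∈ [none] then r else 0) + ∑ i, if e ∈ (P i).1.map some then w i else 0 := by
      cases e <;> simp [parallelFlow, hload]
    convert h <;> rfl

theorem HasPotential.parallel {N : AffineNetwork V E} {price φ r : ℝ} {y : E → ℝ}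
    (hy : N.HasPotential price φ y) (hle : φ ≤ r / N.demand + price)
    (heq : 0 < r → φ = r / N.demand + price) :
    N.parallel.HasPotential price φ (parallelFlow r y) := by
  obtain ⟨π, hs, ht, hπ⟩ := hy
  refine ⟨π, hs, ht, ?_⟩
  rintro (_ | e)
  · have h : N.parallel.edgeCost price none (parallelFlow r y none) = r / N.demand + price := by
      simp [AffineNetwork.parallel, edgeCost, parallelFlow, div_eq_inv_mul]
    have h' : π (N.parallel.head none) - π (N.parallel.tail none) = φ := by
      simp only [AffineNetwork.parallel, Option.elim_none, hs, ht]
      ring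
    rw [h, h']
    exact ⟨hle, heq⟩
  · exact hπ e

end Parallel

end AffineNetwork

namespace AffineNetwork

/-! ### The iterated network and its edge flows. -/

section Nested

/-- The vertices of the `n`-fold nested Braess network. -/
def NestedVertex : ℕ → Type
  | 0 => Bool
  | n + 1 => NestedVertex n ⊕ Bool

/-- The edges of the `n`-fold nested Braess network. -/
def NestedEdge : ℕ → Type
  | 0 => Unit
  | n + 1 => NestedEdge n ⊕ Bool × Bool

instance instFintypeNestedVertex : ∀ n, Fintype (NestedVertex n)
  | 0 => inferInstanceAs (Fintype Bool)
  | n + 1 =>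
    letI := instFintypeNestedVertex n
    inferInstanceAs (Fintype (NestedVertex n ⊕ Bool))

instance instFintypeNestedEdge : ∀ n, Fintype (NestedEdge n)
  | 0 => inferInstanceAs (Fintype Unit)
  | n + 1 =>
    letI := instFintypeNestedEdge n
    inferInstanceAs (Fintype (NestedEdge n ⊕ Bool × Bool))

theorem card_nestedVertex (n : ℕ) : Fintype.card (NestedVertex n) = 2 * n + 2 := by
  induction n with
  | zero => rfl
  | succ n ih =>
    have h : Fintype.card (NestedVertex (n + 1)) = Fintype.card (NestedVertex n) + 2 :=
      Fintype.card_sum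
    omega

theorem card_nestedEdge (n : ℕ) : Fintype.card (NestedEdge n) = 4 * n + 1 := by
  induction n with
  | zero => rfl
  | succ n ih =>
    have h : Fintype.card (NestedEdge (n + 1)) = Fintype.card (NestedEdge n) + 4 :=
      Fintype.card_sum
    omega

/-- The `n`-fold nested Braess network. -/
def nested : ∀ n, AffineNetwork (NestedVertex n) (NestedEdge n)
  | 0 =>
    { tail := fun _ => false
      head := fun _ => true
      source := false
      sink := true
      demand := 1
      a := fun _ => 2
      b := fun _ => 0
      g := fun _ => 0
      demand_pos := one_pos
      a_pos := fun _ => two_pos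
      b_nonneg := fun _ => le_rfl
      g_nonneg := fun _ => le_rfl }
  | n + 1 => (nested n).nest

theorem demand_nested (n : ℕ) : (nested n).demand = 8 ^ n := by
  induction n with
  | zero => rfl
  | succ n ih =>
    have h : (nested (n + 1)).demand = 8 * (nested n).demand := rfl
    rw [h, ih, pow_succ']

theorem source_ne_sink_nested (n : ℕ) : (nested n).source ≠ (nested n).sink := by
  cases n with
  | zero => exact Bool.false_ne_true
  | succ n => exact fun h => Bool.false_ne_true (Sum.inr_injective h)

/-- The innermost edge of the nested Braess network. -/
def coreEdge : ∀ n, NestedEdge n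
  | 0 => ()
  | n + 1 => .inl (coreEdge n)

/-- The edge flow on the nested Braess network that sends `u j` units through the network nested
at depth `j`. -/
noncomputable def nestedFlow (u : ℕ → ℝ) : ∀ n, NestedEdge n → ℝ
  | 0 => fun _ => u 0
  | n + 1 => nestFlow (u n) (u (n + 1)) (nestedFlow u n)

theorem nestedFlow_coreEdge (u : ℕ → ℝ) (n : ℕ) : nestedFlow u n (coreEdge n) = u 0 := by
  induction n with
  | zero => rfl
  | succ n ih => exact ih

theorem nestedFlow_lerp {u v w : ℕ → ℝ} {θ : ℝ} (h : ∀ j, w j = (1 - θ) * u j + θ * v j) (n : ℕ)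
    (e : NestedEdge n) :
    nestedFlow w n e = (1 - θ) * nestedFlow u n e + θ * nestedFlow v n e := by
  induction n with
  | zero => exact h 0
  | succ n ih =>
    obtain e | ⟨_ | _, i⟩ := e
    · exact ih e
    all_goals
      simp only [nestedFlow, nestFlow, Sum.elim_inr, h]
      simp only [if_true, if_false, Bool.false_eq_true]
      ring

theorem decomposes_nestedFlow {u : ℕ → ℝ} (h0 : 0 ≤ u 0) (hu : ∀ j, u j ≤ u (j + 1)) (n : ℕ) :
    (nested n).Decomposes (u n) (nestedFlow u n) := by
  induction n with
  | zero =>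
    refine ⟨Unit, inferInstance,
      fun _ => ⟨[()], ⟨rfl, rfl⟩, by change [false, true].Nodup; decide⟩,
      fun _ => u 0, fun _ => h0, by simp, fun e => ?_⟩
    rw [Fintype.sum_unique]
    exact (if_pos (List.mem_singleton.2 rfl)).symm
  | succ n ih => exact ih.nest (hu n)

end Nested

/-! ### Equilibrium states on the linear pieces, controlled by binary digits. -/

section Equilibrium

/-- Two consecutive binary digits of `i`, starting with digit `j`, differ. -/
def Turns (i j : ℕ) : Prop := i / 2 ^ j % 4 = 1 ∨ i / 2 ^ j % 4 = 2

open Classical in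
/-- The flow through the network nested at depth `j` and the cost of its paths in the equilibrium
with flow `x` on the innermost edge, where both bypasses of this network are used if and only if
`Turns i j`. -/
noncomputable def nestedState (i : ℕ) (x : ℝ) : ℕ → ℝ × ℝ
  | 0 => (x, 2 * x)
  | j + 1 =>
    let s := nestedState i x j
    let u := if Turns i j then 8 * 8 ^ j - 2 * s.2 - 3 * s.1 else s.1
    (u, s.2 + 2 * (u + s.1))

theorem nestedState_succ_of_turns {i j : ℕ} (h : Turns i j) (x : ℝ) :
    (nestedState i x (j + 1)).1 =
        8 * 8 ^ j - 2 * (nestedState i x j).2 - 3 * (nestedState i x j).1 ∧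
      (nestedState i x (j + 1)).2 =
        16 * 8 ^ j - 3 * (nestedState i x j).2 - 4 * (nestedState i x j).1 := by
  simp only [nestedState, if_pos h]
  exact ⟨trivial, by ring⟩

theorem nestedState_succ_of_not_turns {i j : ℕ} (h : ¬Turns i j) (x : ℝ) :
    (nestedState i x (j + 1)).1 = (nestedState i x j).1 ∧
      (nestedState i x (j + 1)).2 = (nestedState i x j).2 + 4 * (nestedState i x j).1 := by
  simp only [nestedState, if_neg h]
  exact ⟨trivial, by ring⟩

theorem nestedState_succ_congr {i i' j : ℕ} {x : ℝ} (h : nestedState i x j = nestedState i' x j)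
    (ht : Turns i j ↔ Turns i' j) : nestedState i x (j + 1) = nestedState i' x (j + 1) := by
  simp only [nestedState, h]
  by_cases h' : Turns i' j
  · rw [if_pos h', if_pos (ht.2 h')]
  · rw [if_neg h', if_neg (ht.not.2 h')]

/-- Both recursion rules map each box into the next. With `d = 8 ^ j`, a turn gives flow in `[d,
8d]` and cost in `[6d, 16d]`; otherwise the flow is at most `d` and the cost at most `6d`. -/
theorem nestedState_mem {x : ℝ} (h0 : 0 ≤ x) (h1 : x ≤ 1) (i j : ℕ) :
    (0 ≤ (nestedState i x j).1 ∧ (nestedState i x j).1 ≤ 8 ^ j) ∧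
      0 ≤ (nestedState i x j).2 ∧ (nestedState i x j).2 ≤ 2 * 8 ^ j := by
  induction j with
  | zero => simp only [nestedState, pow_zero]; exact ⟨⟨h0, h1⟩, by linarith, by linarith⟩
  | succ j ih =>
    obtain ⟨⟨h2, h3⟩, h4, h5⟩ := ih
    rw [pow_succ]
    by_cases h : Turns i j
    · obtain ⟨e1, e2⟩ := nestedState_succ_of_turns h x
      rw [e1, e2]
      refine ⟨⟨?_, ?_⟩, ?_, ?_⟩ <;> linarith
    · obtain ⟨e1, e2⟩ := nestedState_succ_of_not_turns h x
      rw [e1, e2]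
      refine ⟨⟨?_, ?_⟩, ?_, ?_⟩ <;> linarith

theorem nestedState_le_succ {x : ℝ} (h0 : 0 ≤ x) (h1 : x ≤ 1) (i j : ℕ) :
    (nestedState i x j).1 ≤ (nestedState i x (j + 1)).1 ∧
      (nestedState i x j).2 ≤ (nestedState i x (j + 1)).2 := by
  obtain ⟨⟨h2, h3⟩, h4, h5⟩ := nestedState_mem h0 h1 i j
  by_cases h : Turns i j
  · obtain ⟨e1, e2⟩ := nestedState_succ_of_turns h x
    rw [e1, e2]
    constructor <;> linarith
  · obtain ⟨e1, e2⟩ := nestedState_succ_of_not_turns h x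
    rw [e1, e2]
    constructor <;> linarith

/-- For fixed `i` each recursion step is affine in the state. Hence equilibria between two knots are
interpolations of those at the knots. -/
theorem nestedState_lerp (i : ℕ) (x y θ : ℝ) (j : ℕ) :
    (nestedState i ((1 - θ) * x + θ * y) j).1 =
        (1 - θ) * (nestedState i x j).1 + θ * (nestedState i y j).1 ∧
      (nestedState i ((1 - θ) * x + θ * y) j).2 =
        (1 - θ) * (nestedState i x j).2 + θ * (nestedState i y j).2 := by
  induction j with
  | zero => exact ⟨rfl, by simp only [nestedState]; ring⟩
  | succ j ih =>
    by_cases h : Turns i j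
    · simp only [nestedState_succ_of_turns h, ih]
      constructor <;> ring
    · simp only [nestedState_succ_of_not_turns h, ih]
      exact ⟨trivial, by ring⟩

theorem hasPotential_nestedFlow {x : ℝ} (h0 : 0 ≤ x) (h1 : x ≤ 1) (price : ℝ) (i n : ℕ) :
    (nested n).HasPotential price (nestedState i x n).2
      (nestedFlow (fun j => (nestedState i x j).1) n) := by
  induction n with
  | zero =>
    refine ⟨fun v => bif v then x else -x, ?_, ?_, fun e => ?_⟩
    · simp only [nested, nestedState, cond_false]; ring
    · simp only [nested, nestedState, cond_true]; ring
    · have h : x - -x = (2 : ℚ) * x + (0 : ℚ) + (0 : ℚ) * price := by push_cast; ring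
      exact ⟨h.le, fun _ => h⟩
  | succ n ih =>
    have hd : ((nested n).demand : ℝ) = 8 ^ n := by rw [demand_nested]; push_cast; rfl
    obtain ⟨⟨h2, h3⟩, h4, h5⟩ := nestedState_mem h0 h1 i n
    refine HasPotential.nest (u' := (nestedState i x (n + 1)).1) ih ?_ ?_
    · rw [hd]
      by_cases h : Turns i n
      · rw [(nestedState_succ_of_turns h x).1]; linarith
      -- With idle bypasses the condition is `φ + 2 * u ≤ 4 * 8 ^ n`, and the bounds on the state
      -- give it.
      · rw [(nestedState_succ_of_not_turns h x).1]; linarith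
    · rw [hd]
      by_cases h : Turns i n
      · rw [(nestedState_succ_of_turns h x).1]; intro; ring
      · rw [(nestedState_succ_of_not_turns h x).1]; intro h'; exact absurd h' (lt_irrefl _)

/-- The value of the state at the common end point of two consecutive linear pieces. -/
theorem nestedState_succ_eq (i j : ℕ) :
    nestedState i ((i + 1) % 2 : ℕ) j = nestedState (i + 1) ((i + 1) % 2 : ℕ) j ∧
      (2 ^ j ∣ i + 1 → nestedState (i + 1) ((i + 1) % 2 : ℕ) j =
        if (i + 1) / 2 ^ j % 2 = 0 then (0, 0) else (8 ^ j, 2 * 8 ^ j)) := by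
  induction j with
  | zero =>
    refine ⟨rfl, fun _ => ?_⟩
    rcases Nat.mod_two_eq_zero_or_one (i + 1) with h | h <;> simp [nestedState, h]
  | succ j ih =>
    obtain ⟨ih1, ih2⟩ := ih
    by_cases hd : 2 ^ j ∣ i + 1
    · obtain ⟨m, hm⟩ := hd
      have hpos : 0 < 2 ^ j := by positivity
      have e1 : (i + 1) / 2 ^ j = m := by rw [hm, Nat.mul_div_cancel_left _ hpos]
      have hm0 : m ≠ 0 := by rintro rfl; simp at hm
      have e2 : i / 2 ^ j = m - 1 := by
        obtain ⟨m, rfl⟩ := Nat.exists_eq_succ_of_ne_zero hm0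
        rw [Nat.div_eq_iff hpos]
        simp only [Nat.succ_eq_add_one, Nat.add_sub_cancel, mul_add, mul_one] at hm ⊢
        rw [mul_comm m]
        omega
      have e3 : (i + 1) / 2 ^ (j + 1) = m / 2 := by rw [pow_succ, ← Nat.div_div_eq_div_mul, e1]
      have ih3 := ih2 ⟨m, hm⟩
      rw [e1] at ih3
      rcases Nat.mod_two_eq_zero_or_one m with h | h
      -- For even `m`, the residues of `m - 1` and `m` modulo 4 are 3, 0 or 1, 2, so both pieces use
      -- the same rule.
      · rw [if_pos h] at ih3
        have ht : Turns i j ↔ Turns (i + 1) j := by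
          simp only [Turns, e1, e2]; omega
        refine ⟨?_, fun _ => ?_⟩
        · exact nestedState_succ_congr ih1 ht
        · rw [e3]
          by_cases h2 : m / 2 % 2 = 0
          · have : ¬Turns (i + 1) j := by simp only [Turns, e1]; omega
            simp [nestedState, ih3, this, h2]
          · have : Turns (i + 1) j := by simp only [Turns, e1]; omega
            simp only [nestedState, ih3, this, h2, if_true, if_false, pow_succ]
            ext <;> simp <;> ring
      · rw [if_neg (by omega)] at ih3
        refine ⟨?_, fun h2 => ?_⟩
        -- For odd `m` the two pieces use different rules, but the state is the break-even point,
        -- where the rules agree.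
        · have h8 : (8 * 8 ^ j - 2 * (2 * 8 ^ j) - 3 * 8 ^ j : ℝ) = 8 ^ j := by ring
          simp only [nestedState, ih1, ih3, h8, ite_self]
        · rw [hm, pow_succ] at h2
          have := Nat.dvd_of_mul_dvd_mul_left hpos h2
          omega
    · have e1 : (i + 1) / 2 ^ j = i / 2 ^ j := Nat.succ_div_of_not_dvd hd
      have ht : Turns i j ↔ Turns (i + 1) j := by simp only [Turns, e1]
      exact ⟨nestedState_succ_congr ih1 ht,
        fun h => absurd ((pow_dvd_pow 2 j.le_succ).trans h) hd⟩

/-- On the linear piece `i`, flow and path cost at depth `j` increase if the binary digit `j` of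
`i` is zero, and decrease otherwise. -/
theorem nestedState_lt (i j : ℕ) :
    (i / 2 ^ j % 2 = 0 →
      (nestedState i (i % 2 : ℕ) j).1 < (nestedState i ((i + 1) % 2 : ℕ) j).1 ∧
      (nestedState i (i % 2 : ℕ) j).2 < (nestedState i ((i + 1) % 2 : ℕ) j).2) ∧
    (i / 2 ^ j % 2 = 1 →
      (nestedState i ((i + 1) % 2 : ℕ) j).1 < (nestedState i (i % 2 : ℕ) j).1 ∧
      (nestedState i ((i + 1) % 2 : ℕ) j).2 < (nestedState i (i % 2 : ℕ) j).2) := by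
  induction j with
  | zero =>
    rw [pow_zero, Nat.div_one]
    refine ⟨fun h => ?_, fun h => ?_⟩
    · have h' : (i + 1) % 2 = 1 := by omega
      simp [nestedState, h, h']
    · have h' : (i + 1) % 2 = 0 := by omega
      simp [nestedState, h, h']
  | succ j ih =>
    have e : i / 2 ^ (j + 1) = i / 2 ^ j / 2 := by rw [pow_succ, ← Nat.div_div_eq_div_mul]
    rw [e]
    obtain ⟨ih0, ih1⟩ := ih
    by_cases h : Turns i j
    -- A turn reverses direction, since both new components have negative coefficients in the old
    -- ones; it also means that digits `j` and `j + 1` differ.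
    · simp only [nestedState_succ_of_turns h]
      simp only [Turns] at h
      refine ⟨fun h' => ?_, fun h' => ?_⟩
      · obtain ⟨h1, h2⟩ := ih1 (by omega)
        constructor <;> linarith
      · obtain ⟨h1, h2⟩ := ih0 (by omega)
        constructor <;> linarith
    · simp only [nestedState_succ_of_not_turns h]
      simp only [Turns] at h
      refine ⟨fun h' => ?_, fun h' => ?_⟩
      · obtain ⟨h1, h2⟩ := ih0 (by omega)
        constructor <;> linarith
      · obtain ⟨h1, h2⟩ := ih1 (by omega)
        constructor <;> linarith

/-- The edge flow on the nested network with a priced edge that belongs to `nestedState i x`. -/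
noncomputable def pricedFlow (n i : ℕ) (x : ℝ) : Option (NestedEdge n) → ℝ :=
  parallelFlow (8 ^ n - (nestedState i x n).1) (nestedFlow (fun j => (nestedState i x j).1) n)

/-- The price at which `pricedFlow n i x` is an equilibrium. -/
noncomputable def flowPrice (n i : ℕ) (x : ℝ) : ℝ :=
  (nestedState i x n).2 - (8 ^ n - (nestedState i x n).1) / 8 ^ n

theorem pricedFlow_core (n i : ℕ) (x : ℝ) : pricedFlow n i x (some (coreEdge n)) = x :=
  nestedFlow_coreEdge _ n

theorem pricedFlow_lerp (n i : ℕ) (x y θ : ℝ) (e : Option (NestedEdge n)) :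
    pricedFlow n i ((1 - θ) * x + θ * y) e =
      (1 - θ) * pricedFlow n i x e + θ * pricedFlow n i y e := by
  cases e with
  | none =>
    simp only [pricedFlow, parallelFlow, Option.elim_none, nestedState_lerp]
    ring
  | some e => exact nestedFlow_lerp (fun j => (nestedState_lerp i x y θ j).1) n e

theorem flowPrice_lerp (n i : ℕ) (x y θ : ℝ) :
    flowPrice n i ((1 - θ) * x + θ * y) = (1 - θ) * flowPrice n i x + θ * flowPrice n i y := by
  simp only [flowPrice, nestedState_lerp]
  ring

/-- The price is determined only while the priced edge is used; once the nested network carries the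
full demand, any higher price supports the same flow. -/
theorem isWardropEdgeFlow_pricedFlow {x : ℝ} (h0 : 0 ≤ x) (h1 : x ≤ 1) (n i : ℕ) {price : ℝ}
    (hle : flowPrice n i x ≤ price)
    (heq : (nestedState i x n).1 < 8 ^ n → price = flowPrice n i x) :
    (nested n).parallel.IsWardropEdgeFlow price (pricedFlow n i x) := by
  have hd : ((nested n).demand : ℝ) = 8 ^ n := by rw [demand_nested]; push_cast; rfl
  have hdec := (decomposes_nestedFlow (u := fun j => (nestedState i x j).1) h0
    (fun j => (nestedState_le_succ h0 h1 i j).1) n).parallel (source_ne_sink_nested n)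
    (sub_nonneg.2 (nestedState_mem h0 h1 i n).1.2)
  have hpot := (hasPotential_nestedFlow h0 h1 price i n).parallel
    (r := 8 ^ n - (nestedState i x n).1)
    (by rw [hd]; unfold flowPrice at hle; linarith)
    (fun h => by rw [hd, heq (by linarith), flowPrice]; ring)
  refine Decomposes.isWardropEdgeFlow ?_ hpot
  have : ((nested n).parallel.demand : ℝ) =
      (nestedState i x n).1 + (8 ^ n - (nestedState i x n).1) := by
    rw [add_sub_cancel]; exact hd
  rw [this]
  exact hdec

end Equilibrium

/-! ### Knots, linear interpolation and the count of breakpoints. -/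

section Knots

/-- The end points of the linear pieces of the equilibrium in the price. -/
noncomputable def knotPrice (n i : ℕ) : ℝ := flowPrice n i (i % 2 : ℕ)

/-- The equilibrium edge flows at the end points of the linear pieces. -/
noncomputable def knotFlow (n i : ℕ) : Option (NestedEdge n) → ℝ := pricedFlow n i (i % 2 : ℕ)

theorem knotPrice_succ (n i : ℕ) : knotPrice n (i + 1) = flowPrice n i ((i + 1) % 2 : ℕ) := by
  simp only [knotPrice, flowPrice, nestedState_succ_eq]

theorem knotFlow_succ (n i : ℕ) : knotFlow n (i + 1) = pricedFlow n i ((i + 1) % 2 : ℕ) := by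
  simp only [knotFlow, pricedFlow, nestedState_succ_eq]

theorem knotPrice_lt_succ {n i : ℕ} (hi : i < 2 ^ n) : knotPrice n i < knotPrice n (i + 1) := by
  rw [knotPrice_succ, knotPrice, flowPrice, flowPrice]
  -- Digit `n` of `i < 2 ^ n` is zero, so the outermost flow and cost rise on every piece.
  obtain ⟨h1, h2⟩ := (nestedState_lt i n).1 (by rw [Nat.div_eq_of_lt hi])
  have h8 : (0 : ℝ) < 8 ^ n := by positivity
  have := div_lt_div_of_pos_right h1 h8
  simp only [sub_div]
  linarith

theorem knotPrice_lt {n i j : ℕ} (hij : i < j) (hj : j ≤ 2 ^ n) :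
    knotPrice n i < knotPrice n j := by
  induction j, hij using Nat.le_induction with
  | base => exact knotPrice_lt_succ hj
  | succ j _ ih => exact (ih (by omega)).trans (knotPrice_lt_succ hj)

theorem knotPrice_zero_neg (n : ℕ) : knotPrice n 0 < 0 := by
  have h (j : ℕ) : nestedState 0 0 j = (0, 0) := by
    induction j with
    | zero => simp [nestedState]
    | succ j ih => simp [nestedState, ih, Turns]
  simp [knotPrice, flowPrice, h]

/-- Path cost never decreases with depth and starts at 2, while the priced edge subtracts at most 1.
So all knots except knot 0 lie at positive prices. -/
theorem knotPrice_one_pos (n : ℕ) : 0 < knotPrice n 1 := by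
  have h (j : ℕ) : 2 ≤ (nestedState 1 1 j).2 := by
    induction j with
    | zero => simp [nestedState]
    | succ j ih => exact ih.trans (nestedState_le_succ zero_le_one le_rfl 1 j).2
  have h8 : (0 : ℝ) < 8 ^ n := by positivity
  have h1 := (nestedState_mem zero_le_one (le_refl (1 : ℝ)) 1 n).1.1
  have h2 := div_nonneg h1 h8.le
  have h3 := h n
  simp only [knotPrice, flowPrice, sub_div, div_self h8.ne', Nat.one_mod, Nat.cast_one]
  linarith

/-- Between two consecutive knots, the equilibrium is affine in the price, and the direction in
which the flow on the innermost edge moves alternates. -/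
theorem exists_slope {n i : ℕ} (hi : i < 2 ^ n) :
    ∃ m : Option (NestedEdge n) → ℝ, 0 < (-1) ^ i * m (some (coreEdge n)) ∧
      knotFlow n (i + 1) = knotFlow n i + (knotPrice n (i + 1) - knotPrice n i) • m ∧
      ∀ t, knotPrice n i ≤ t → t ≤ knotPrice n (i + 1) →
        (nested n).parallel.IsWardropEdgeFlow t (knotFlow n i + (t - knotPrice n i) • m) := by
  have hd := sub_pos.2 (knotPrice_lt_succ hi)
  refine ⟨(knotPrice n (i + 1) - knotPrice n i)⁻¹ • (knotFlow n (i + 1) - knotFlow n i),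
    ?_, ?_, fun t h0 h1 => ?_⟩
  · have h : (0 : ℝ) < (-1) ^ i * (((i + 1) % 2 : ℕ) - (i % 2 : ℕ) : ℝ) := by
      rcases Nat.even_or_odd i with h | h
      · rw [h.neg_one_pow, Nat.even_iff.1 h, show (i + 1) % 2 = 1 by grind]
        norm_num
      · rw [h.neg_one_pow, Nat.odd_iff.1 h, show (i + 1) % 2 = 0 by grind]
        norm_num
    simp only [Pi.smul_apply, Pi.sub_apply, smul_eq_mul, knotFlow, pricedFlow_core]
    rw [mul_left_comm]
    exact mul_pos (inv_pos.2 hd) h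
  · rw [smul_inv_smul₀ hd.ne']
    abel
  · set θ := (t - knotPrice n i) / (knotPrice n (i + 1) - knotPrice n i) with hθ
    have hθ0 : 0 ≤ θ := div_nonneg (by linarith) hd.le
    have hθ1 : θ ≤ 1 := (div_le_one hd).2 (by linarith)
    have hc (k : ℕ) : (0 : ℝ) ≤ (k % 2 : ℕ) ∧ ((k % 2 : ℕ) : ℝ) ≤ 1 :=
      ⟨Nat.cast_nonneg _, by exact_mod_cast Nat.lt_succ_iff.1 (Nat.mod_lt k two_pos)⟩
    set x : ℝ := (1 - θ) * (i % 2 : ℕ) + θ * ((i + 1) % 2 : ℕ) with hx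
    have hx0 : 0 ≤ x := add_nonneg (mul_nonneg (by linarith) (hc i).1) (mul_nonneg hθ0 (hc _).1)
    have hx1 : x ≤ 1 := by nlinarith [hc i, hc (i + 1)]
    have hp : flowPrice n i x = t := by
      rw [hx, flowPrice_lerp, ← knotPrice_succ, ← knotPrice]
      have : θ * (knotPrice n (i + 1) - knotPrice n i) = t - knotPrice n i :=
        div_mul_cancel₀ _ hd.ne'
      linarith
    have hf : knotFlow n i + (t - knotPrice n i) •
        ((knotPrice n (i + 1) - knotPrice n i)⁻¹ • (knotFlow n (i + 1) - knotFlow n i)) =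
        pricedFlow n i x := by
      funext e
      rw [hx, pricedFlow_lerp, knotFlow_succ, smul_smul, ← div_eq_mul_inv, ← hθ]
      simp only [Pi.add_apply, Pi.smul_apply, Pi.sub_apply, smul_eq_mul, knotFlow]
      ring
    rw [hf]
    exact isWardropEdgeFlow_pricedFlow hx0 hx1 n i hp.le fun _ => hp.symm

theorem isWardropEdgeFlow_of_last_knot_le {n : ℕ} {t : ℝ} (ht : knotPrice n (2 ^ n) ≤ t) :
    (nested n).parallel.IsWardropEdgeFlow t (knotFlow n (2 ^ n)) := by
  have h1 : 2 ^ n - 1 + 1 = 2 ^ n := Nat.sub_add_cancel Nat.one_le_two_pow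
  have h := (nestedState_succ_eq (2 ^ n - 1) n).2
  rw [h1, Nat.div_self (by positivity), if_neg (by norm_num)] at h
  refine isWardropEdgeFlow_pricedFlow (Nat.cast_nonneg _)
    (by exact_mod_cast Nat.lt_succ_iff.1 (Nat.mod_lt _ two_pos)) n _ ht fun h2 => ?_
  rw [h dvd_rfl] at h2
  exact absurd h2 (lt_irrefl _)

theorem exists_isWardropEdgeFlow (n : ℕ) {t : ℝ} (ht : 0 < t) :
    ∃ y, (nested n).parallel.IsWardropEdgeFlow t y := by
  by_cases h : knotPrice n (2 ^ n) ≤ t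
  · exact ⟨_, isWardropEdgeFlow_of_last_knot_le h⟩
  · have hex : ∃ i, t < knotPrice n i := ⟨_, not_le.1 h⟩
    classical
    have h1 := Nat.find_spec hex
    have h2 : Nat.find hex ≤ 2 ^ n := Nat.find_min' hex (not_le.1 h)
    obtain ⟨i, hi⟩ : ∃ i, Nat.find hex = i + 1 := by
      refine Nat.exists_eq_succ_of_ne_zero fun h0 => ?_
      rw [h0] at h1
      exact absurd (h1.trans (knotPrice_zero_neg n)) ht.not_gt
    have h3 : ¬t < knotPrice n i := Nat.find_min hex (by omega)
    rw [hi] at h1 h2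
    obtain ⟨m, -, -, hm⟩ := exists_slope (n := n) (i := i) (by omega)
    exact ⟨_, hm t (not_lt.1 h3) h1.le⟩

theorem isBreakpoint_knotPrice {n i : ℕ} (hi0 : 0 < i) (hi : i < 2 ^ n)
    {x : ℝ → Option (NestedEdge n) → ℝ}
    (hx : ∀ t, 0 < t → ∀ y, (nested n).parallel.IsWardropEdgeFlow t y → y = x t) :
    0 < knotPrice n i ∧ IsBreakpoint x (knotPrice n i) := by
  obtain ⟨i, rfl⟩ := Nat.exists_eq_succ_of_ne_zero hi0.ne'
  rw [Nat.succ_eq_add_one] at *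
  have hpos : 0 < knotPrice n (i + 1) := by
    rcases Nat.eq_zero_or_pos i with rfl | h
    · exact knotPrice_one_pos n
    · exact (knotPrice_one_pos n).trans (knotPrice_lt (by omega) hi.le)
  refine ⟨hpos, ?_⟩
  obtain ⟨m₁, hs₁, he₁, hw₁⟩ := exists_slope (n := n) (i := i) (by omega)
  obtain ⟨m₂, hs₂, -, hw₂⟩ := exists_slope hi
  have hlt₁ := knotPrice_lt_succ (n := n) (i := i) (by omega)
  have hlt₂ := knotPrice_lt_succ hi
  set p₀ := knotPrice n i
  set p₁ := knotPrice n (i + 1)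
  set p₂ := knotPrice n (i + 1 + 1)
  have hxp : x p₁ = knotFlow n (i + 1) := by
    have := hx p₁ hpos _ (hw₂ p₁ le_rfl hlt₂.le)
    rw [← this, sub_self, zero_smul, add_zero]
  -- The bound `p₁ / 2` keeps prices positive, where `x` is known to be the equilibrium; the others
  -- stay within the adjacent pieces.
  refine ⟨min (p₁ / 2) (min (p₁ - p₀) (p₂ - p₁)), ?_, m₁, m₂, ?_, fun h h0 h1 => ⟨?_, ?_⟩⟩
  · exact lt_min (half_pos hpos) (lt_min (sub_pos.2 hlt₁) (sub_pos.2 hlt₂))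
  -- Equal slopes would give the core edge a derivative of both signs.
  · rintro rfl
    rw [pow_succ] at hs₂
    linarith
  · obtain ⟨h2, h3, h4⟩ := by simpa only [le_min_iff] using h1
    rw [← hx (p₁ - h) (by linarith) _ (hw₁ _ (by linarith) (by linarith)), hxp, he₁]
    module
  · obtain ⟨h2, h3, h4⟩ := by simpa only [le_min_iff] using h1
    rw [← hx (p₁ + h) (by linarith) _ (hw₂ _ (by linarith) (by linarith)), hxp,
      add_sub_cancel_left]

theorem le_encard_isBreakpoint {n : ℕ} {x : ℝ → Option (NestedEdge n) → ℝ}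
    (hx : ∀ t, 0 < t → ∀ y, (nested n).parallel.IsWardropEdgeFlow t y → y = x t) :
    ((2 ^ n - 1 : ℕ) : ℕ∞) ≤ {t : ℝ | 0 < t ∧ IsBreakpoint x t}.encard := by
  have hinj : Set.InjOn (knotPrice n) (Finset.Ioo 0 (2 ^ n) : Finset ℕ) := by
    refine StrictMonoOn.injOn fun i _ j hj hij => knotPrice_lt hij ?_
    exact (Finset.mem_Ioo.1 (Finset.mem_coe.1 hj)).2.le
  have hcard : ((2 ^ n - 1 : ℕ) : ℕ∞) =
      (knotPrice n '' (Finset.Ioo 0 (2 ^ n) : Finset ℕ)).encard := by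
    rw [hinj.encard_image, Set.encard_coe_eq_coe_finsetCard, Nat.card_Ioo, Nat.sub_zero]
  rw [hcard]
  refine Set.encard_le_encard ?_
  rintro _ ⟨i, hi, rfl⟩
  obtain ⟨h0, h1⟩ := Finset.mem_Ioo.1 (Finset.mem_coe.1 hi)
  exact isBreakpoint_knotPrice h0 h1 hx

end Knots

end AffineNetwork

theorem mainTheorem12 :
    ∃ C : ℕ, ∀ k : ℕ, ∃ (V E : Type) (_ : Fintype V) (_ : Fintype E) (N : AffineNetwork V E),
      Fintype.card V ≤ C * (k + 1) ∧ Fintype.card E ≤ C * (k + 1) ∧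
      ∃ x : ℝ → E → ℝ,
        (∀ price : ℝ, 0 < price → ∀ y : E → ℝ, N.IsWardropEdgeFlow price y ↔ y = x price) ∧
        2 ^ (k + 1) ≤ {price : ℝ | 0 < price ∧ IsBreakpoint x price}.encard := by
  -- Depth `k + 2` gives `2 * k + 6` vertices and `4 * k + 10` edges. One level beyond `k + 1`
  -- absorbs the loss of 1 in `2 ^ n - 1`.
  refine ⟨11, fun k => ?_⟩
  choose! x hx using fun t => AffineNetwork.exists_isWardropEdgeFlow (k + 2) (t := t)
  refine ⟨AffineNetwork.NestedVertex (k + 2), Option (AffineNetwork.NestedEdge (k + 2)),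
    inferInstance, inferInstance, (AffineNetwork.nested (k + 2)).parallel, ?_, ?_, x,
    fun t ht y => ⟨fun hy => hy.unique (hx t ht), fun hy => hy ▸ hx t ht⟩, ?_⟩
  · rw [AffineNetwork.card_nestedVertex]
    omega
  · rw [Fintype.card_option, AffineNetwork.card_nestedEdge]
    omega
  · refine le_trans ?_ (AffineNetwork.le_encard_isBreakpoint fun t ht y hy => hy.unique (hx t ht))
    have h : 2 ^ (k + 1) ≤ 2 ^ (k + 2) - 1 := by
      have : 1 ≤ 2 ^ k := Nat.one_le_two_pow
      rw [pow_succ, pow_add]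
      omega
    exact_mod_cast h
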